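/- Let $\mathbb F_q$ be a finite field with $q$ elements, $K=\mathbb F_q((t^{-1}))$, and for $0\ne f=\sum_{i\le n}a_it^i\in K$ with $a_n\neq 0$ put $\deg f=n$, $|f|=q^{n}$ and $[f]=\sum_{0\le i\le n}a_it^i$; put $\deg 0=-\infty$, $|0|=0$ and $[0]=0$. Let $\mathcal O=\{f\in K:|f|\le 1\}$ and let $\mu$ be the Haar measure on $(K,+)$ normalized by $\mu(\mathcal O)=1$. Fix $h\in K$ with $\deg h=-1$. For $f\in\mathcal O$ let $F_h$ be the algebraic Farey map $$F_h(f)=\begin{cases}\dfrac{f}{1-[(1-h)f^{-1}]f},&\deg f\le -1,\\[2mm] \dfrac{1-[(1-h)f^{-1}]f}{f},&\deg f=0,\end{cases}$$ (with $F_h(0)=0$), and for $f\in\mathcal O\setminus\{0\}$ let $$M_h(f)=\begin{pmatrix}1&0\\ [(1-h)f^{-1}]&1\end{pmatrix}\ \text{if }\deg f<0,\qquad M_h(f)=\begin{pmatrix}0&1\\ 1&[(1-h)f^{-1}]\end{pmatrix}\ \text{if }\deg f=0.$$ For $\ell\ge 1$ let $\begin{pmatrix}U_\ell\\ V_\ell\end{pmatrix}$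 be the first column of the product $M_h(f)\,M_h(F_h(f))\cdots M_h(F_h^{\ell-1}(f))$ (the principal and intermediate convergents $U_\ell/V_\ell$ of $f$ produced by $F_h$). Then for $\mu$-almost every $f\in\mathcal O$, $$\lim_{\ell\to\infty}\frac1\ell\log_q\left|f-\frac{U_\ell}{V_\ell}\right|=-\frac{2q}{2q-1}.$$ -/

import Mathlib

open MeasureTheory Filter Topology

noncomputable section

namespace FareyMap

/-! The field `K = 𝔽_q((t⁻¹))` is `LaurentSeries F`, the Laurent series variable being `t⁻¹`: the
coefficient of `t ^ n` in `f` is `f.coeff (-n)`.  The topology on `LaurentSeries F` is Mathlib's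
valuation topology. -/

variable {F : Type*} [Field F]

open Classical in
/-- The degree of `f` in `t`, with `deg 0 = -∞`. -/
def deg (f : LaurentSeries F) : WithBot ℤ :=
  if f = 0 then ⊥ else ((-f.order : ℤ) : WithBot ℤ)

open Classical in
/-- The absolute value `|f| = q ^ deg f`, with `|0| = 0`. -/
def absVal [Fintype F] (f : LaurentSeries F) : ℝ :=
  if f = 0 then 0 else (Fintype.card F : ℝ) ^ (-f.order)

/-- The polynomial part `[f]`: the terms of `f` with nonnegative powers of `t`. -/
def polyPart (f : LaurentSeries F) : LaurentSeries F :=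
  HahnSeries.truncLT (1 : ℤ) f

open Classical in
/-- The algebraic Farey map `F_h` (meant on the elements of degree at most `0`). -/
def fareyMap (h f : LaurentSeries F) : LaurentSeries F :=
  if deg f ≤ ((-1 : ℤ) : WithBot ℤ) then
    f / (1 - polyPart ((1 - h) * f⁻¹) * f)
  else
    (1 - polyPart ((1 - h) * f⁻¹) * f) / f

open Classical in
/-- The matrix `M_h(f)` (meant for `f` of degree at most `0`). -/
def fareyMatrix (h f : LaurentSeries F) : Matrix (Fin 2) (Fin 2) (LaurentSeries F) :=
  if deg f ≤ ((-1 : ℤ) : WithBot ℤ) then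
    !![1, 0; polyPart ((1 - h) * f⁻¹), 1]
  else
    !![0, 1; 1, polyPart ((1 - h) * f⁻¹)]

/-- The product `M_h(f) M_h(F_h(f)) ⋯ M_h(F_h^{ℓ-1}(f))` of `ℓ` matrices. -/
def fareyProd (h f : LaurentSeries F) : ℕ → Matrix (Fin 2) (Fin 2) (LaurentSeries F)
  | 0 => 1
  | ℓ + 1 => fareyProd h f ℓ * fareyMatrix h ((fareyMap h)^[ℓ] f)

/-- The numerator `U_ℓ`: upper entry of the first column of the product of `ℓ` matrices. -/
def convNum (h f : LaurentSeries F) (ℓ : ℕ) : LaurentSeries F := fareyProd h f ℓ 0 0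

/-- The denominator `V_ℓ`: lower entry of the first column of the product of `ℓ` matrices. -/
def convDen (h f : LaurentSeries F) (ℓ : ℕ) : LaurentSeries F := fareyProd h f ℓ 1 0

end FareyMap

end

/-!
The error of the convergents of `F_h` is controlled by the ordinary continued fraction of `f`, which
does not depend on `h`.

Put `g = f⁻¹`. While `deg g ≥ 1`, one Farey step replaces `g` by `g - [(1 - h) g]`, which is
`h g` plus a term of negative degree and so has degree `deg g - 1`; when `deg g = 0`, the step yields
`g - [(1 - h) g]` itself, of negative degree. All that is ever subtracted is a polynomial, so when
the degree first becomes negative, the result is the fractional part of the original `g`: a digit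
of degree `n` costs `n + 1` Farey steps, after which the Gauss map `gaussMap` has been applied once
(`iterate_fareyMap_digit`). Following the matrices through such a block, with
`f - U / V = ± 1 / (V (V f_ℓ + V'))`, shows that if step `ℓ` falls in the block of index `i`, the
order of the error is `2 (ℓ - i)` up to the degrees of two neighbouring digits
(`NonTerminating.abs_order_error_sub_le`).

It remains to know the frequency of block ends. For almost every `f` the degrees of the digits obey
the strong law of large numbers with mean `q / (q - 1)`. Indeed the branch of the Gauss map with
first digit `a` multiplies all distances by `|a| ^ 2`, so it pulls balls back to balls
(`sphere_inter_preimage_ball`); hence the normalized Haar measure on the series of negative degree is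
invariant, and the degree of the first digit is independent of the image under the Gauss map
(`unitMeasure_preimage_inter_preimage`). Thus the digit degrees are pairwise independent and
identically distributed, and their mean is `∑ j, q ^ (-j)`. With `m = q / (q - 1)`, a block has
average length `m + 1` and contributes `2 m` to the order of the error, which gives the limit
`2 m / (m + 1) = 2 q / (2 q - 1)` (`tendsto_div_of_block_bound`).
-/

open MeasureTheory Filter Topology

noncomputable section

namespace FareyMap

section

variable {F : Type*} [Field F]

/-! ### Orders and polynomial parts -/

lemma orderTop_inv_of_eq {f : LaurentSeries F} {n : ℤ} (hf : f.orderTop = n) :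
    f⁻¹.orderTop = ((-n : ℤ) : WithTop ℤ) := by
  have hf0 : f ≠ 0 := by
    rintro rfl
    simp at hf
  have h := HahnSeries.orderTop_mul f f⁻¹
  rw [mul_inv_cancel₀ hf0, HahnSeries.orderTop_one, hf,
    ← HahnSeries.order_eq_orderTop_of_ne_zero (inv_ne_zero hf0)] at h
  rw [← HahnSeries.order_eq_orderTop_of_ne_zero (inv_ne_zero hf0)]
  have h' : (0 : ℤ) = n + (f⁻¹).order := by exact_mod_cast h
  exact_mod_cast (by omega : (f⁻¹).order = -n)

lemma orderTop_mul_of_eq {f g : LaurentSeries F} {m n : ℤ} (hf : f.orderTop = m)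
    (hg : g.orderTop = n) : (f * g).orderTop = ((m + n : ℤ) : WithTop ℤ) := by
  rw [HahnSeries.orderTop_mul, hf, hg]
  rfl

lemma ne_zero_of_orderTop_eq {f : LaurentSeries F} {n : ℤ} (hf : f.orderTop = n) : f ≠ 0 := by
  rintro rfl
  simp at hf

lemma order_eq_of_orderTop_eq {f : LaurentSeries F} {n : ℤ} (hf : f.orderTop = n) :
    f.order = n := by
  rw [← HahnSeries.order_eq_orderTop_of_ne_zero (ne_zero_of_orderTop_eq hf)] at hf
  exact_mod_cast hf

lemma lt_orderTop_iff {f : LaurentSeries F} {n : ℤ} :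
    (n : WithTop ℤ) < f.orderTop ↔ ∀ i ≤ n, f.coeff i = 0 := by
  constructor
  · intro h i hi
    exact HahnSeries.coeff_eq_zero_of_lt_orderTop (lt_of_le_of_lt (by exact_mod_cast hi) h)
  · intro h
    by_contra hn
    have hf : f ≠ 0 := by
      rintro rfl
      simp at hn
    rw [← HahnSeries.order_eq_orderTop_of_ne_zero hf] at hn
    have hn' : f.order ≤ n := by exact_mod_cast not_lt.mp hn
    exact hf (HahnSeries.coeff_order_eq_zero.1 (h _ hn'))

lemma polyPart_add (f g : LaurentSeries F) : polyPart (f + g) = polyPart f + polyPart g :=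
  HahnSeries.truncLT_add _ _ _

lemma polyPart_eq_zero {f : LaurentSeries F} (hf : ((0 : ℤ) : WithTop ℤ) < f.orderTop) :
    polyPart f = 0 := by
  ext i
  rw [lt_orderTop_iff] at hf
  simp only [polyPart, HahnSeries.coeff_truncLT, HahnSeries.coeff_zero]
  split_ifs with hi
  · exact hf i (by omega)
  · rfl

lemma polyPart_polyPart (f : LaurentSeries F) : polyPart (polyPart f) = polyPart f := by
  ext i
  simp only [polyPart, HahnSeries.coeff_truncLT]
  split_ifs <;> rfl

lemma zero_lt_orderTop_sub_polyPart (f : LaurentSeries F) :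
    ((0 : ℤ) : WithTop ℤ) < (f - polyPart f).orderTop := by
  rw [lt_orderTop_iff]
  intro i hi
  simp [polyPart, HahnSeries.coeff_truncLT, show i < 1 by omega]

lemma orderTop_polyPart {f : LaurentSeries F} {n : ℤ} (hn : n ≤ 0) (hf : f.orderTop = n) :
    (polyPart f).orderTop = n := by
  have h : polyPart f = f - (f - polyPart f) := by ring
  rw [h, HahnSeries.orderTop_sub, hf]
  rw [hf]
  exact lt_of_le_of_lt (by exact_mod_cast hn) (zero_lt_orderTop_sub_polyPart f)

/-- The polynomial part of `f` is the only polynomial that differs from `f` by a series of positive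
order. -/
lemma polyPart_eq_of_sub {f a : LaurentSeries F} (ha : polyPart a = a)
    (h : ((0 : ℤ) : WithTop ℤ) < (f - a).orderTop) : polyPart f = a := by
  have h1 : f = a + (f - a) := by ring
  rw [h1, polyPart_add, ha, polyPart_eq_zero h, add_zero]

/-- The Gauss map `f ↦ f⁻¹ - [f⁻¹]` of the continued fraction algorithm. -/
def gaussMap (f : LaurentSeries F) : LaurentSeries F := f⁻¹ - polyPart f⁻¹

lemma zero_lt_orderTop_gaussMap (f : LaurentSeries F) :
    ((0 : ℤ) : WithTop ℤ) < (gaussMap f).orderTop :=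
  zero_lt_orderTop_sub_polyPart _

/-! ### The Farey map along one digit of the continued fraction -/

lemma deg_le_neg_one_iff {f : LaurentSeries F} {n : ℤ} (hf : f.orderTop = n) :
    deg f ≤ ((-1 : ℤ) : WithBot ℤ) ↔ 1 ≤ n := by
  rw [deg, if_neg (ne_zero_of_orderTop_eq hf), order_eq_of_orderTop_eq hf, WithBot.coe_le_coe]
  omega

lemma orderTop_eq_one_of_deg {h : LaurentSeries F} (hh : deg h = ((-1 : ℤ) : WithBot ℤ)) :
    h.orderTop = ((1 : ℤ) : WithTop ℤ) := by
  rw [deg] at hh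
  split_ifs at hh with h0
  · simp at hh
  · rw [← HahnSeries.order_eq_orderTop_of_ne_zero h0]
    have : -h.order = -1 := by exact_mod_cast hh
    exact_mod_cast (by omega : h.order = 1)

lemma fareyMap_of_pos (h : LaurentSeries F) {f : LaurentSeries F} {n : ℤ} (hf : f.orderTop = n)
    (hn : 1 ≤ n) : fareyMap h f = (f⁻¹ - polyPart ((1 - h) * f⁻¹))⁻¹ := by
  have hf0 := ne_zero_of_orderTop_eq hf
  rw [fareyMap, if_pos ((deg_le_neg_one_iff hf).2 hn), ← inv_div]
  congr 1
  field_simp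

lemma fareyMap_of_zero (h : LaurentSeries F) {f : LaurentSeries F}
    (hf : f.orderTop = ((0 : ℤ) : WithTop ℤ)) :
    fareyMap h f = f⁻¹ - polyPart ((1 - h) * f⁻¹) := by
  have hf0 := ne_zero_of_orderTop_eq hf
  rw [fareyMap, if_neg (by rw [deg_le_neg_one_iff hf]; omega)]
  field_simp

lemma inv_sub_eq (h f : LaurentSeries F) : f⁻¹ - polyPart ((1 - h) * f⁻¹) =
    h * f⁻¹ + ((1 - h) * f⁻¹ - polyPart ((1 - h) * f⁻¹)) := by ring

/-- The summand `h * f⁻¹` is not subtracted by `fareyMap`, so the degree of `f⁻¹` drops by exactly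
one. -/
lemma orderTop_inv_sub_of_pos {h : LaurentSeries F} (hh : h.orderTop = ((1 : ℤ) : WithTop ℤ))
    {f : LaurentSeries F} {n : ℤ} (hf : f.orderTop = n) (hn : 1 ≤ n) :
    (f⁻¹ - polyPart ((1 - h) * f⁻¹)).orderTop = ((1 - n : ℤ) : WithTop ℤ) := by
  have h1 := orderTop_mul_of_eq hh (orderTop_inv_of_eq hf)
  rw [inv_sub_eq, HahnSeries.orderTop_add_eq_left, h1, sub_eq_add_neg]
  rw [h1]
  exact lt_of_le_of_lt (by exact_mod_cast (by omega : 1 + -n ≤ 0))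
    (zero_lt_orderTop_sub_polyPart _)

lemma zero_lt_orderTop_inv_sub_of_zero {h : LaurentSeries F}
    (hh : h.orderTop = ((1 : ℤ) : WithTop ℤ)) {f : LaurentSeries F}
    (hf : f.orderTop = ((0 : ℤ) : WithTop ℤ)) :
    ((0 : ℤ) : WithTop ℤ) < (f⁻¹ - polyPart ((1 - h) * f⁻¹)).orderTop := by
  have h1 := orderTop_mul_of_eq hh (orderTop_inv_of_eq hf)
  rw [inv_sub_eq]
  refine lt_of_lt_of_le (lt_min ?_ (zero_lt_orderTop_sub_polyPart _))
    HahnSeries.min_orderTop_le_orderTop_add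
  rw [h1]
  exact_mod_cast (by norm_num : (0 : ℤ) < 1 + -0)

lemma iterate_fareyMap_add (h f : LaurentSeries F) (S k : ℕ) :
    (fareyMap h)^[S + k] f = (fareyMap h)^[k] ((fareyMap h)^[S] f) := by
  rw [add_comm, Function.iterate_add_apply]

lemma fareyProd_add (h f : LaurentSeries F) (S k : ℕ) :
    fareyProd h f (S + k) = fareyProd h f S * fareyProd h ((fareyMap h)^[S] f) k := by
  induction k with
  | zero => simp [fareyProd]
  | succ k ih =>
    rw [← add_assoc, fareyProd, ih, fareyProd, iterate_fareyMap_add, mul_assoc]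

/-- Starting from `g` of order `n`, each of the first `n` Farey steps subtracts a polynomial from
the inverse and lowers the order by one. -/
lemma fareyProd_of_le {h : LaurentSeries F} (hh : h.orderTop = ((1 : ℤ) : WithTop ℤ))
    {g : LaurentSeries F} {n : ℕ} (hg : g.orderTop = ((n : ℤ) : WithTop ℤ)) {k : ℕ} (hk : k ≤ n) :
    ∃ B : LaurentSeries F, polyPart B = B ∧ (fareyMap h)^[k] g = (g⁻¹ - B)⁻¹ ∧
      ((fareyMap h)^[k] g).orderTop = ((n - k : ℤ) : WithTop ℤ) ∧
      fareyProd h g k = !![1, 0; B, 1] := by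
  induction k with
  | zero =>
    refine ⟨0, polyPart_eq_zero (by simp), by simp, by simpa using hg, ?_⟩
    rw [fareyProd]
    exact Matrix.one_fin_two
  | succ k ih =>
    obtain ⟨B, hB, hy, ho, hP⟩ := ih (by omega)
    set y := (fareyMap h)^[k] g
    have hn : (1 : ℤ) ≤ n - k := by omega
    have hy' : y⁻¹ = g⁻¹ - B := by rw [hy, inv_inv]
    refine ⟨B + polyPart ((1 - h) * y⁻¹), ?_, ?_, ?_, ?_⟩
    · rw [polyPart_add, hB, polyPart_polyPart]
    · rw [Function.iterate_succ_apply', fareyMap_of_pos h ho hn]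
      nth_rewrite 1 [hy']
      rw [sub_sub]
    · rw [Function.iterate_succ_apply', fareyMap_of_pos h ho hn,
        orderTop_inv_of_eq (orderTop_inv_sub_of_pos hh ho hn)]
      congr 1
      push_cast
      ring
    · rw [fareyProd, hP, fareyMatrix, if_pos ((deg_le_neg_one_iff ho).2 hn)]
      simp [y]

/-- After `n + 1` Farey steps from `g` of order `n`, the polynomials subtracted from `g⁻¹` add up
to its whole polynomial part: the Gauss map has been applied once. -/
lemma iterate_fareyMap_digit {h : LaurentSeries F} (hh : h.orderTop = ((1 : ℤ) : WithTop ℤ))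
    {g : LaurentSeries F} {n : ℕ} (hg : g.orderTop = ((n : ℤ) : WithTop ℤ)) :
    (fareyMap h)^[n + 1] g = gaussMap g ∧
      fareyProd h g (n + 1) = !![0, 1; 1, polyPart g⁻¹] := by
  obtain ⟨B, hB, hy, ho, hP⟩ := fareyProd_of_le hh hg le_rfl
  set y := (fareyMap h)^[n] g with hydef
  rw [sub_self] at ho
  have hy' : y⁻¹ = g⁻¹ - B := by rw [hy, inv_inv]
  have hpos := zero_lt_orderTop_inv_sub_of_zero hh ho
  have hA : polyPart g⁻¹ = B + polyPart ((1 - h) * y⁻¹) := by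
    refine polyPart_eq_of_sub (by rw [polyPart_add, hB, polyPart_polyPart]) ?_
    rwa [← sub_sub, ← hy']
  constructor
  · rw [Function.iterate_succ_apply', ← hydef, fareyMap_of_zero h ho, gaussMap, hA, ← sub_sub,
      ← hy']
  · rw [fareyProd, hP, ← hydef, fareyMatrix,
      if_neg (by rw [deg_le_neg_one_iff ho]; omega), hA]
    simp

/-! ### Convergents -/

/-- The Möbius relation `f = (a y + b) / (c y + d)`, cleared of its denominator. -/
def MoebiusRel (P : Matrix (Fin 2) (Fin 2) (LaurentSeries F)) (y f : LaurentSeries F) : Prop :=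
  f * (P 1 0 * y + P 1 1) = P 0 0 * y + P 0 1

/-- Clearing denominators makes the composition rule hold with no nonvanishing hypothesis. -/
lemma MoebiusRel.mul {P Q : Matrix (Fin 2) (Fin 2) (LaurentSeries F)} {y g f : LaurentSeries F}
    (hP : MoebiusRel P g f) (hQ : MoebiusRel Q y g) : MoebiusRel (P * Q) y f := by
  unfold MoebiusRel at *
  simp only [Matrix.mul_apply, Fin.sum_univ_two]
  linear_combination (f * P 1 0 - P 0 0) * (-hQ) + (Q 1 0 * y + Q 1 1) * hP

/-- The degree of the `i`-th digit (partial quotient) in the continued fraction of `f`, counted from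
`0`: the order of the `i`-th iterate of the Gauss map. It is `0` if the expansion has ended before,
since the order of `0` is `0`. -/
def digit (f : LaurentSeries F) (i : ℕ) : ℕ := ((gaussMap^[i] f).order).toNat

/-- The sum of the first `i` digit degrees, which is the degree of the `i`-th convergent
denominator. -/
def digitSum (f : LaurentSeries F) (i : ℕ) : ℕ := ∑ j ∈ Finset.range i, digit f j

lemma digitSum_succ (f : LaurentSeries F) (i : ℕ) :
    digitSum f (i + 1) = digitSum f i + digit f i := Finset.sum_range_succ _ _

/-- `f` has nonnegative order and an infinite continued fraction expansion. -/
def NonTerminating (f : LaurentSeries F) : Prop :=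
  0 ≤ f.orderTop ∧ ∀ i, gaussMap^[i] f ≠ 0

variable {h f : LaurentSeries F}

lemma NonTerminating.orderTop_iterate (hf : NonTerminating f) (i : ℕ) :
    (gaussMap^[i] f).orderTop = ((digit f i : ℤ) : WithTop ℤ) := by
  have h0 := hf.2 i
  rw [digit, ← HahnSeries.order_eq_orderTop_of_ne_zero h0, Int.toNat_of_nonneg]
  rw [← HahnSeries.zero_le_orderTop_iff]
  cases i with
  | zero => exact hf.1
  | succ i =>
    rw [Function.iterate_succ_apply']
    exact (zero_lt_orderTop_gaussMap _).le

lemma NonTerminating.one_le_digit (hf : NonTerminating f) (i : ℕ) : 1 ≤ digit f (i + 1) := by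
  have h1 := zero_lt_orderTop_gaussMap (gaussMap^[i] f)
  rw [← Function.iterate_succ_apply' gaussMap, hf.orderTop_iterate] at h1
  exact_mod_cast h1

/-- The state of the Farey algorithm when `i` digits are complete. The lower left entry is the
previous denominator, and `0` at the start. -/
lemma NonTerminating.block_start (hf : NonTerminating f)
    (hh : h.orderTop = ((1 : ℤ) : WithTop ℤ)) (i : ℕ) :
    (fareyMap h)^[digitSum f i + i] f = gaussMap^[i] f ∧
    MoebiusRel (fareyProd h f (digitSum f i + i)) (gaussMap^[i] f) f ∧
    ((fareyProd h f (digitSum f i + i)).det = 1 ∨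
      (fareyProd h f (digitSum f i + i)).det = -1) ∧
    (fareyProd h f (digitSum f i + i) 1 1).orderTop = ((-digitSum f i : ℤ) : WithTop ℤ) ∧
    (fareyProd h f (digitSum f i + i) 1 0).orderTop =
      if i = 0 then ⊤ else ((-digitSum f (i - 1) : ℤ) : WithTop ℤ) := by
  induction i with
  | zero => simp [digitSum, fareyProd, MoebiusRel]
  | succ i ih =>
    obtain ⟨hy, hM, hdet, h11, h10⟩ := ih
    have hs : digitSum f (i + 1) + (i + 1) = (digitSum f i + i) + (digit f i + 1) := by
      rw [digitSum_succ]; omega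
    have ho := hf.orderTop_iterate i
    obtain ⟨hd1, hd2⟩ := iterate_fareyMap_digit hh ho
    have hP := fareyProd_add h f (digitSum f i + i) (digit f i + 1)
    rw [hy, hd2] at hP
    have ha : (polyPart (gaussMap^[i] f)⁻¹).orderTop = ((-digit f i : ℤ) : WithTop ℤ) :=
      orderTop_polyPart (by omega) (orderTop_inv_of_eq ho)
    rw [hs]
    refine ⟨?_, ?_, ?_, ?_, ?_⟩
    · rw [iterate_fareyMap_add, hy, hd1, Function.iterate_succ_apply']
    · rw [hP]
      refine hM.mul ?_
      rw [Function.iterate_succ_apply']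
      simp [MoebiusRel, gaussMap, mul_inv_cancel₀ (hf.2 i)]
    · rw [hP, Matrix.det_mul, Matrix.det_fin_two_of]
      rcases hdet with hd | hd <;> simp [hd]
    · have hmul := orderTop_mul_of_eq h11 ha
      have hlt : ((-digitSum f i + -digit f i : ℤ) : WithTop ℤ) <
          (fareyProd h f (digitSum f i + i) 1 0).orderTop := by
        rw [h10]
        split_ifs with hi
        · exact WithTop.coe_lt_top _
        · obtain ⟨j, rfl⟩ := Nat.exists_eq_succ_of_ne_zero hi
          have := hf.one_le_digit j
          rw [Nat.succ_eq_add_one, Nat.add_sub_cancel, digitSum_succ]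
          exact_mod_cast (by push_cast; omega)
      rw [hP]
      simp only [Matrix.mul_apply, Fin.sum_univ_two]
      simp only [Matrix.of_apply, Matrix.cons_val', Matrix.cons_val_zero, Matrix.cons_val_one,
        Matrix.cons_val_fin_one, mul_one]
      rw [HahnSeries.orderTop_add_eq_right (by rw [hmul]; exact hlt), hmul, digitSum_succ]
      congr 1
      push_cast
      ring
    · rw [hP]
      simp only [Matrix.mul_apply, Fin.sum_univ_two]
      simp [h11]

/-- Within a digit, the error of the Farey convergent has order twice the number of Farey steps
spent on negative degrees, up to the degrees of the current and of the previous digit. -/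
lemma NonTerminating.abs_order_error_sub_le (hf : NonTerminating f)
    (hh : h.orderTop = ((1 : ℤ) : WithTop ℤ)) {i k : ℕ} (hi : 1 ≤ i) (hk : k ≤ digit f i) :
    f - convNum h f (digitSum f i + i + k) / convDen h f (digitSum f i + i + k) ≠ 0 ∧
    |(f - convNum h f (digitSum f i + i + k) / convDen h f (digitSum f i + i + k)).order
      - 2 * (digitSum f i + k : ℤ)| ≤ digit f i + digit f (i - 1) := by
  obtain ⟨j, rfl⟩ : ∃ j, i = j + 1 := ⟨i - 1, by omega⟩
  obtain ⟨hy, hM, hdet, h11, h10⟩ := hf.block_start hh (j + 1)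
  have hx := hf.orderTop_iterate (j + 1)
  obtain ⟨B, hB, hz, hzo, hQ⟩ := fareyProd_of_le hh hx hk
  have hn := hf.one_le_digit j
  have hP := fareyProd_add h f (digitSum f (j + 1) + (j + 1)) k
  rw [hy, hQ] at hP
  have hx0 := hf.2 (j + 1)
  simp only [Nat.add_eq_zero_iff, one_ne_zero, and_false, if_false, Nat.add_sub_cancel] at h10
  rw [Nat.add_sub_cancel]
  set x := gaussMap^[j + 1] f
  set z := (fareyMap h)^[k] x
  set P := fareyProd h f (digitSum f (j + 1) + (j + 1))
  have hz0 := ne_zero_of_orderTop_eq hzo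
  have hzi : z⁻¹ = x⁻¹ - B := by rw [hz, inv_inv]
  have hM' : MoebiusRel (P * !![1, 0; B, 1]) z f := by
    refine hM.mul ?_
    have h1 : z * (x⁻¹ - B) = 1 := by rw [← hzi, mul_inv_cancel₀ hz0]
    have h2 : x * x⁻¹ = 1 := mul_inv_cancel₀ hx0
    simp only [MoebiusRel, Matrix.of_apply, Matrix.cons_val', Matrix.cons_val_zero,
      Matrix.cons_val_one, Matrix.cons_val_fin_one, one_mul, add_zero]
    linear_combination (-x) * h1 + z * h2
  have hdet' : (P * !![1, 0; B, 1]).det = 1 ∨ (P * !![1, 0; B, 1]).det = -1 := by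
    rw [Matrix.det_mul, Matrix.det_fin_two_of]
    simpa using hdet
  rw [convNum, convDen, hP]
  have hU0 : (P * !![1, 0; B, 1]) 1 0 = P 1 0 + P 1 1 * B := by
    simp [Matrix.mul_apply, Fin.sum_univ_two]
  have hU1 : (P * !![1, 0; B, 1]) 1 1 = P 1 1 := by
    simp [Matrix.mul_apply, Fin.sum_univ_two]
  have hxi := orderTop_inv_of_eq hx
  have hlt : ((-digitSum f (j + 1) + -digit f (j + 1) : ℤ) : WithTop ℤ) < (P 1 0).orderTop := by
    rw [h10, digitSum_succ]
    exact_mod_cast (by push_cast; omega)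
  -- the order of `V_ℓ f_ℓ + V'_ℓ`
  have hJ : ((P * !![1, 0; B, 1]) 1 0 * z + (P * !![1, 0; B, 1]) 1 1).orderTop =
      ((-digitSum f (j + 1) - k : ℤ) : WithTop ℤ) := by
    have h1 : (P * !![1, 0; B, 1]) 1 0 * z + (P * !![1, 0; B, 1]) 1 1 =
        (P 1 0 + P 1 1 * x⁻¹) * z := by
      rw [hU0, hU1]
      have h1 : z * (x⁻¹ - B) = 1 := by rw [← hzi, mul_inv_cancel₀ hz0]
      linear_combination (-P 1 1) * h1
    have h2 := orderTop_mul_of_eq h11 hxi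
    have h3 : (P 1 0 + P 1 1 * x⁻¹).orderTop = _ :=
      (HahnSeries.orderTop_add_eq_right (by rw [h2]; exact hlt)).trans h2
    rw [h1, orderTop_mul_of_eq h3 hzo]
    congr 1
    ring
  -- the order of `V_ℓ`: at `k = 0` it still comes from the previous digit, and from `k = 1` on it
  -- already has the value it has at the end of the current one
  have hV : ∃ v : ℤ, (P 1 0 + P 1 1 * B).orderTop = ((-v : ℤ) : WithTop ℤ) ∧
      |v - (digitSum f (j + 1) + k : ℤ)| ≤ digit f (j + 1) + digit f j := by
    rcases Nat.eq_zero_or_pos k with rfl | hk0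
    · have hB0 : B = 0 := by
        have : z = x := rfl
        rw [this] at hzi
        linear_combination hzi
      refine ⟨digitSum f j, by rw [hB0, mul_zero, add_zero, h10], ?_⟩
      rw [digitSum_succ, abs_le]
      push_cast
      omega
    · have hBo : B.orderTop = ((-digit f (j + 1) : ℤ) : WithTop ℤ) := by
        have h1 : B = x⁻¹ - z⁻¹ := by rw [hzi]; ring
        rw [h1, HahnSeries.orderTop_sub, hxi]
        rw [hxi, orderTop_inv_of_eq hzo]
        exact_mod_cast (by omega)
      have h2 := orderTop_mul_of_eq h11 hBo
      refine ⟨digitSum f (j + 1) + digit f (j + 1), ?_, ?_⟩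
      · rw [HahnSeries.orderTop_add_eq_right (by rw [h2]; exact hlt), h2]
        congr 1
        ring
      · rw [abs_le]
        omega
  obtain ⟨v, hv, hvb⟩ := hV
  rw [← hU0] at hv
  rw [Matrix.det_fin_two] at hdet'
  unfold MoebiusRel at hM'
  generalize P * !![1, 0; B, 1] = Q at *
  have hV0 := ne_zero_of_orderTop_eq hv
  have hJ0 := ne_zero_of_orderTop_eq hJ
  -- the error is `-det / (V_ℓ (V_ℓ f_ℓ + V'_ℓ))`
  have herr : f - Q 0 0 / Q 1 0 =
      -(Q 0 0 * Q 1 1 - Q 0 1 * Q 1 0) * (Q 1 0 * (Q 1 0 * z + Q 1 1))⁻¹ := by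
    field_simp
    linear_combination Q 1 0 * hM'
  have hone : (-(Q 0 0 * Q 1 1 - Q 0 1 * Q 1 0)).orderTop = ((0 : ℤ) : WithTop ℤ) := by
    rw [HahnSeries.orderTop_neg]
    rcases hdet' with hd | hd
    · rw [hd, HahnSeries.orderTop_one]; rfl
    · rw [hd, HahnSeries.orderTop_neg, HahnSeries.orderTop_one]; rfl
  have hord := orderTop_mul_of_eq hone (orderTop_inv_of_eq (orderTop_mul_of_eq hv hJ))
  rw [← herr] at hord
  refine ⟨ne_zero_of_orderTop_eq hord, ?_⟩
  rw [order_eq_of_orderTop_eq hord]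
  rw [abs_le] at hvb ⊢
  omega

end

section

variable {F : Type*} [Field F]

/-! ### Balls of Laurent series -/

/-- The open ball of center `x` and radius `q ^ (-n)`: the series that agree with `x` up to the
coefficient of index `n` included, that is, the `f` with `deg (f - x) < -n`. -/
def ball (x : LaurentSeries F) (n : ℤ) : Set (LaurentSeries F) :=
  {f | (n : WithTop ℤ) < (f - x).orderTop}

lemma mem_ball {x f : LaurentSeries F} {n : ℤ} :
    f ∈ ball x n ↔ ∀ i ≤ n, f.coeff i = x.coeff i := by
  simp only [ball, Set.mem_ofPred_eq, lt_orderTop_iff, HahnSeries.coeff_sub, sub_eq_zero]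

lemma mem_ball_zero {f : LaurentSeries F} {n : ℤ} :
    f ∈ ball 0 n ↔ (n : WithTop ℤ) < f.orderTop := by
  simp [ball]

lemma self_mem_ball (x : LaurentSeries F) (n : ℤ) : x ∈ ball x n :=
  mem_ball.2 fun _ _ => rfl

lemma ball_subset {x y : LaurentSeries F} {m n : ℤ} (hmn : m ≤ n) (hy : y ∈ ball x m) :
    ball y n ⊆ ball x m := by
  intro f hf
  rw [mem_ball] at *
  exact fun i hi => (hf i (hi.trans hmn)).trans (hy i hi)

lemma mem_ball_comm {x y : LaurentSeries F} {n : ℤ} : y ∈ ball x n ↔ x ∈ ball y n := by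
  simp only [mem_ball, eq_comm]

lemma ball_eq_of_mem {x y : LaurentSeries F} {n : ℤ} (hy : y ∈ ball x n) : ball y n = ball x n :=
  (ball_subset le_rfl hy).antisymm (ball_subset le_rfl (mem_ball_comm.1 hy))

lemma mem_nhds_iff_ball {s : Set (LaurentSeries F)} {x : LaurentSeries F} :
    s ∈ 𝓝 x ↔ ∃ n : ℕ, ball x n ⊆ s := by
  rw [Valued.mem_nhds]
  constructor
  · rintro ⟨γ, hγ⟩
    obtain ⟨m, hm⟩ : ∃ m : ℤ, WithZero.exp m =
        MonoidWithZeroHom.ValueGroup₀.embedding γ.1 :=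
      ⟨_, WithZero.exp_log (by simp)⟩
    refine ⟨(-m).toNat, fun f hf => hγ ?_⟩
    rw [Set.mem_ofPred_eq, Valuation.restrict_lt_iff_lt_embedding, ← hm]
    refine lt_of_le_of_lt ((LaurentSeries.valuation_le_iff_coeff_lt_eq_zero F
      (D := 1 - m)).2 fun i hi => ?_) (WithZero.exp_lt_exp.2 (by omega : -(1 - m) < m))
    rw [HahnSeries.coeff_sub, mem_ball.1 hf i (by omega), sub_self]
  · rintro ⟨n, hn⟩
    have hv := LaurentSeries.valuation_single_zpow F (n : ℤ)
    refine ⟨Units.mk0 (Valued.v.restrict (HahnSeries.single (n : ℤ) (1 : F))) ?_,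
      fun f hf => hn ?_⟩
    · simp
    · rw [Set.mem_ofPred_eq, Units.val_mk0, Valuation.restrict_lt_iff, hv] at hf
      rw [mem_ball]
      intro i hi
      have h1 : Valued.v (f - x) ≤ WithZero.exp (-((n : ℤ) + 1)) := by
        rcases eq_or_ne (Valued.v (f - x)) 0 with h0 | h0
        · rw [h0]; exact zero_le
        · rw [← WithZero.exp_log h0, WithZero.exp_lt_exp] at hf
          rw [← WithZero.exp_log h0, WithZero.exp_le_exp]
          omega
      have h2 := (LaurentSeries.valuation_le_iff_coeff_lt_eq_zero F).1 h1 i (by omega)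
      rwa [HahnSeries.coeff_sub, sub_eq_zero] at h2

lemma isOpen_ball (x : LaurentSeries F) (n : ℤ) : IsOpen (ball x n) := by
  rw [isOpen_iff_mem_nhds]
  intro y hy
  exact mem_nhds_iff_ball.2 ⟨n.toNat, ball_subset (Int.self_le_toNat n) hy⟩

/-- The open balls of radius at most `1`, about all centers. -/
def smallBalls (F : Type*) [Field F] : Set (Set (LaurentSeries F)) :=
  {s | ∃ (x : LaurentSeries F) (n : ℕ), s = ball x n}

lemma isTopologicalBasis_smallBalls :
    TopologicalSpace.IsTopologicalBasis (smallBalls F) := by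
  refine TopologicalSpace.isTopologicalBasis_of_isOpen_of_nhds ?_ ?_
  · rintro _ ⟨x, n, rfl⟩
    exact isOpen_ball x n
  · intro x u hx hu
    obtain ⟨n, hn⟩ := mem_nhds_iff_ball.1 (hu.mem_nhds hx)
    exact ⟨_, ⟨x, n, rfl⟩, self_mem_ball x n, hn⟩

lemma isPiSystem_smallBalls : IsPiSystem (smallBalls F) := by
  rintro _ ⟨x, m, rfl⟩ _ ⟨y, n, rfl⟩ ⟨z, hz1, hz2⟩
  rw [← ball_eq_of_mem hz1, ← ball_eq_of_mem hz2]
  refine ⟨z, max m n, Set.Subset.antisymm ?_ ?_⟩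
  · rintro f ⟨h1, h2⟩
    rw [mem_ball] at *
    intro i hi
    rcases le_max_iff.1 (by exact_mod_cast hi : i ≤ max (m : ℤ) n) with h | h
    exacts [h1 i h, h2 i h]
  · exact fun f hf => ⟨ball_subset (by simp) (self_mem_ball _ _) hf,
      ball_subset (by simp) (self_mem_ball _ _) hf⟩

/-- Over a countable field only countably many series have no terms of index `≥ n`. -/
lemma countable_truncLT [Countable F] (n : ℤ) :
    (Set.range fun f : LaurentSeries F => HahnSeries.truncLT n f).Countable := by
  refine (Set.countable_range
    (fun p : ℤ →₀ F => (HahnSeries.ofFinsupp p : LaurentSeries F))).mono ?_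
  rintro _ ⟨f, rfl⟩
  have hfin : (Function.support (HahnSeries.truncLT n f).coeff).Finite := by
    refine (Set.finite_Ico f.order n).subset fun i hi => ?_
    rw [Function.mem_support, HahnSeries.coeff_truncLT] at hi
    split_ifs at hi with h
    · exact ⟨HahnSeries.order_le_of_coeff_ne_zero hi, h⟩
    · simp at hi
  refine ⟨Finsupp.ofSupportFinite _ hfin, ?_⟩
  ext i
  rfl

instance secondCountableTopology_laurentSeries [Countable F] :
    SecondCountableTopology (LaurentSeries F) := by
  refine isTopologicalBasis_smallBalls.secondCountableTopology ?_
  refine (Set.countable_iUnion fun n : ℕ =>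
    (countable_truncLT (F := F) (n + 1)).image fun x => ball x n).mono ?_
  rintro _ ⟨x, n, rfl⟩
  refine Set.mem_iUnion.2 ⟨n, _, ⟨x, rfl⟩, ball_eq_of_mem (mem_ball.2 fun i hi => ?_)⟩
  exact HahnSeries.coeff_truncLT_of_lt (by omega) x

lemma continuous_polyPart : Continuous (polyPart (F := F)) := by
  refine IsLocallyConstant.continuous ((IsLocallyConstant.iff_exists_open _).2 fun x =>
    ⟨ball x 0, isOpen_ball x 0, self_mem_ball x 0, fun y hy => ?_⟩)
  ext i
  simp only [polyPart, HahnSeries.coeff_truncLT]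
  split_ifs with hi
  · exact mem_ball.1 hy i (by omega)
  · rfl

variable [MeasurableSpace (LaurentSeries F)] [BorelSpace (LaurentSeries F)]

lemma measurable_gaussMap : Measurable (gaussMap (F := F)) := by
  have h : Continuous fun f : LaurentSeries F => f - polyPart f :=
    continuous_id.sub continuous_polyPart
  exact h.measurable.comp measurable_inv

lemma measurableSet_ball (x : LaurentSeries F) (n : ℤ) : MeasurableSet (ball x n) :=
  (isOpen_ball x n).measurableSet

/-! ### Haar measure of balls -/

variable (μ : Measure (LaurentSeries F)) [μ.IsAddHaarMeasure]

lemma measure_ball (x : LaurentSeries F) (n : ℤ) : μ (ball x n) = μ (ball 0 n) := by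
  rw [← measure_preimage_add μ (-x) (ball 0 n)]
  congr 1
  ext f
  simp [ball, sub_eq_neg_add]

lemma measure_ball_succ [Fintype F] (n : ℤ) :
    μ (ball 0 n) = Fintype.card F * μ (ball 0 (n + 1)) := by
  have h : ball (0 : LaurentSeries F) n =
      ⋃ c : F, ball (HahnSeries.single (n + 1) c) (n + 1) := by
    ext f
    simp only [Set.mem_iUnion, mem_ball]
    constructor
    · intro hf
      refine ⟨f.coeff (n + 1), fun i hi => ?_⟩
      rcases eq_or_ne i (n + 1) with rfl | hne
      · simp
      · rw [HahnSeries.coeff_single_of_ne hne, hf i (by omega), HahnSeries.coeff_zero]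
    · rintro ⟨c, hc⟩ i hi
      rw [hc i (by omega), HahnSeries.coeff_single_of_ne (by omega), HahnSeries.coeff_zero]
  rw [h, measure_iUnion _ fun c => measurableSet_ball _ _]
  · simp [measure_ball μ (HahnSeries.single _ _)]
  · intro c d hcd
    rw [Function.onFun, Set.disjoint_left]
    intro f hc hd
    rw [mem_ball] at hc hd
    have := (hc _ le_rfl).symm.trans (hd _ le_rfl)
    simp only [HahnSeries.coeff_single_same] at this
    exact hcd this

lemma measure_ball_add [Fintype F] (n : ℤ) (k : ℕ) :
    μ (ball 0 (n + k)) = (Fintype.card F : ENNReal)⁻¹ ^ k * μ (ball 0 n) := by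
  induction k with
  | zero => simp
  | succ k ih =>
    rw [pow_succ', mul_assoc, ← ih, measure_ball_succ μ (n + k), ← mul_assoc,
      ENNReal.inv_mul_cancel (by simp) (by simp), one_mul]
    push_cast
    rw [add_assoc]

lemma measure_singleton_zero [Fintype F] (hfin : μ (ball 0 0) ≠ ⊤) : μ {0} = 0 := by
  have hlim : Tendsto (fun k : ℕ => (Fintype.card F : ENNReal)⁻¹ ^ k * μ (ball 0 0)) atTop
      (𝓝 (0 * μ (ball 0 0))) := by
    refine ENNReal.Tendsto.mul_const
      (ENNReal.tendsto_pow_atTop_nhds_zero_of_lt_one ?_) (Or.inr hfin)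
    rw [ENNReal.inv_lt_one]
    exact_mod_cast Fintype.one_lt_card
  rw [zero_mul] at hlim
  refine le_antisymm (ge_of_tendsto' hlim fun k => ?_) (zero_le)
  rw [← measure_ball_add μ 0 k]
  exact measure_mono (Set.singleton_subset_iff.2 (self_mem_ball _ _))

end

section

variable {F : Type*} [Field F]

/-! ### The Gauss map and Haar measure -/

/-- The series of order exactly `k`. -/
def sphere (F : Type*) [Field F] (k : ℕ) : Set (LaurentSeries F) :=
  {f | f.orderTop = ((k : ℤ) : WithTop ℤ)}

/-- The polynomials of degree exactly `k`, which are the possible digits of degree `k`. -/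
def digitsOfDegree (F : Type*) [Field F] (k : ℕ) : Set (LaurentSeries F) :=
  {a | polyPart a = a ∧ a.orderTop = ((-k : ℤ) : WithTop ℤ)}

lemma countable_digitsOfDegree [Countable F] (k : ℕ) : (digitsOfDegree F k).Countable :=
  (countable_truncLT (F := F) 1).mono fun a ha => Set.mem_range.2 ⟨a, ha.1⟩

lemma sphere_eq (k : ℕ) : sphere F k = ball 0 (k - 1) \ ball 0 k := by
  ext f
  simp only [sphere, Set.mem_ofPred_eq, Set.mem_sdiff, mem_ball_zero, not_lt]
  rcases eq_or_ne f 0 with rfl | hf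
  · simp
  · rw [← HahnSeries.order_eq_orderTop_of_ne_zero hf]
    simp only [WithTop.coe_inj, WithTop.coe_lt_coe, WithTop.coe_le_coe]
    omega

lemma lt_orderTop_mul {f g : LaurentSeries F} {m n : ℤ} (hf : (m : WithTop ℤ) < f.orderTop)
    (hg : g.orderTop = n) : ((m + n : ℤ) : WithTop ℤ) < (f * g).orderTop := by
  rcases eq_or_ne f 0 with rfl | hf0
  · simp
  · have h := (HahnSeries.order_eq_orderTop_of_ne_zero hf0).symm
    rw [orderTop_mul_of_eq h hg]
    rw [h] at hf
    have hf' : m < f.order := by exact_mod_cast hf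
    exact_mod_cast (by omega : m + n < f.order + n)

lemma orderTop_add_of_mem_digitsOfDegree {k : ℕ} {a x : LaurentSeries F}
    (ha : a ∈ digitsOfDegree F k) (hx : ((0 : ℤ) : WithTop ℤ) < x.orderTop) :
    (a + x).orderTop = ((-k : ℤ) : WithTop ℤ) := by
  rw [HahnSeries.orderTop_add_eq_left, ha.2]
  rw [ha.2]
  exact lt_of_le_of_lt (by exact_mod_cast (by omega : -(k : ℤ) ≤ 0)) hx

/-- The inverse branch `y ↦ (a + y)⁻¹` of the Gauss map multiplies distances by `|a| ^ (-2)`, and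
the digit `a` is constant on the image of a ball. -/
lemma gaussMap_mem_ball_of_mem {k n : ℕ} {a x f : LaurentSeries F}
    (ha : a ∈ digitsOfDegree F k) (hx : ((0 : ℤ) : WithTop ℤ) < x.orderTop)
    (hf : f ∈ ball ((a + x)⁻¹) (n + (2 * k : ℕ))) :
    f ∈ sphere F k ∧ polyPart f⁻¹ = a ∧ gaussMap f ∈ ball x n := by
  have h1 := orderTop_add_of_mem_digitsOfDegree ha hx
  have h1i := orderTop_inv_of_eq h1
  rw [neg_neg] at h1i
  have h10 := ne_zero_of_orderTop_eq h1
  have hfo : f.orderTop = ((k : ℤ) : WithTop ℤ) := by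
    have h2 : f = (a + x)⁻¹ + (f - (a + x)⁻¹) := by ring
    rw [h2, HahnSeries.orderTop_add_eq_left, h1i]
    rw [h1i]
    refine lt_of_le_of_lt ?_ hf
    exact_mod_cast (by omega)
  have h0 := ne_zero_of_orderTop_eq hfo
  have h2 := lt_orderTop_mul (lt_orderTop_mul hf (orderTop_inv_of_eq hfo)) h1
  have hcast : (n : ℤ) + (2 * k : ℕ) + -k + -k = n := by
    push_cast
    ring
  have h3 : f⁻¹ - a - x = -((f - (a + x)⁻¹) * f⁻¹ * (a + x)) := by
    have e1 := mul_inv_cancel₀ h0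
    have e2 := mul_inv_cancel₀ h10
    linear_combination (a + x) * e1 - f⁻¹ * e2
  have h4 : ((n : ℤ) : WithTop ℤ) < (f⁻¹ - a - x).orderTop := by
    rw [h3, HahnSeries.orderTop_neg]
    rwa [hcast] at h2
  have h5 : polyPart f⁻¹ = a := by
    refine polyPart_eq_of_sub ha.1 ?_
    have h6 : f⁻¹ - a = x + (f⁻¹ - a - x) := by ring
    rw [h6]
    refine lt_of_lt_of_le (lt_min hx (lt_of_le_of_lt ?_ h4))
      HahnSeries.min_orderTop_le_orderTop_add
    exact_mod_cast Nat.zero_le n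
  refine ⟨hfo, h5, ?_⟩
  rw [ball, Set.mem_ofPred_eq, gaussMap, h5]
  exact h4

/-- Each branch of the Gauss map pulls a ball back to a ball. -/
lemma sphere_inter_preimage_ball (k n : ℕ) {x : LaurentSeries F} (hx : x ∈ ball 0 0) :
    sphere F k ∩ gaussMap ⁻¹' ball x n =
      ⋃ a ∈ digitsOfDegree F k, ball ((a + x)⁻¹) (n + (2 * k : ℕ)) := by
  rw [mem_ball_zero] at hx
  ext f
  simp only [Set.mem_inter_iff, Set.mem_iUnion, Set.mem_preimage, exists_prop]
  constructor
  · rintro ⟨hf, hT⟩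
    have hfi := orderTop_inv_of_eq hf
    have ha : polyPart f⁻¹ ∈ digitsOfDegree F k :=
      ⟨polyPart_polyPart _, orderTop_polyPart (by omega) hfi⟩
    refine ⟨_, ha, ?_⟩
    have h1 := orderTop_add_of_mem_digitsOfDegree ha hx
    have h2 := lt_orderTop_mul (lt_orderTop_mul hT hf) (orderTop_inv_of_eq h1)
    have h3 : f - (polyPart f⁻¹ + x)⁻¹ =
        -((gaussMap f - x) * f * (polyPart f⁻¹ + x)⁻¹) := by
      have e1 := mul_inv_cancel₀ (ne_zero_of_orderTop_eq hf)
      have e2 := mul_inv_cancel₀ (ne_zero_of_orderTop_eq h1)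
      rw [gaussMap]
      linear_combination (polyPart f⁻¹ + x)⁻¹ * e1 - f * e2
    rw [ball, Set.mem_ofPred_eq, h3, HahnSeries.orderTop_neg]
    convert h2 using 2
    push_cast
    ring
  · rintro ⟨a, ha, hf⟩
    obtain ⟨h1, -, h2⟩ := gaussMap_mem_ball_of_mem ha hx hf
    exact ⟨h1, h2⟩

variable [MeasurableSpace (LaurentSeries F)] [BorelSpace (LaurentSeries F)]

lemma measurableSet_sphere (k : ℕ) : MeasurableSet (sphere F k) := by
  rw [sphere_eq]
  exact (measurableSet_ball _ _).diff (measurableSet_ball _ _)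

variable [Fintype F] (μ : Measure (LaurentSeries F)) [μ.IsAddHaarMeasure]

lemma measure_sphere_inter_preimage_ball (k n : ℕ) {x : LaurentSeries F} (hx : x ∈ ball 0 0) :
    μ (sphere F k ∩ gaussMap ⁻¹' ball x n) =
      (∑' _ : digitsOfDegree F k, (Fintype.card F : ENNReal)⁻¹ ^ (2 * k)) * μ (ball x n) := by
  rw [sphere_inter_preimage_ball k n hx, measure_biUnion (countable_digitsOfDegree k) _
    fun a _ => measurableSet_ball _ _, ← ENNReal.tsum_mul_right]
  · refine tsum_congr fun a => ?_
    rw [measure_ball, measure_ball_add, measure_ball μ x]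
  · intro a ha b hb hab
    rw [Function.onFun, Set.disjoint_left]
    intro f hfa hfb
    rw [mem_ball_zero] at hx
    exact hab ((gaussMap_mem_ball_of_mem ha hx hfa).2.1.symm.trans
      (gaussMap_mem_ball_of_mem hb hx hfb).2.1)

/-- Given that the first digit has degree `k`, the image under the Gauss map is uniformly
distributed on the series of negative degree. -/
lemma measure_sphere_inter_preimage (hfin : μ (ball 0 (-1)) ≠ ⊤) (k : ℕ)
    {B : Set (LaurentSeries F)} (hB : MeasurableSet B) :
    μ (sphere F k ∩ gaussMap ⁻¹' B) * μ (ball 0 0) = μ (sphere F k) * μ (B ∩ ball 0 0) := by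
  have hsub : sphere F k ⊆ ball 0 (-1) := by
    rw [sphere_eq]
    exact Set.sdiff_subset.trans (ball_subset (by omega) (self_mem_ball _ _))
  -- the number of digits of degree `k` need not be computed: `B = ball 0 0` determines `C`
  set C := ∑' _ : digitsOfDegree F k, (Fintype.card F : ENNReal)⁻¹ ^ (2 * k)
  have huniv : gaussMap ⁻¹' ball (0 : LaurentSeries F) (0 : ℕ) = Set.univ :=
    Set.eq_univ_of_forall fun f => mem_ball_zero.2 (zero_lt_orderTop_gaussMap f)
  have hC : μ (sphere F k) = C * μ (ball 0 0) := by
    have h1 := measure_sphere_inter_preimage_ball μ k 0 (self_mem_ball 0 0)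
    rwa [huniv, Set.inter_univ] at h1
  have hfinS : IsFiniteMeasure (μ.restrict (sphere F k)) :=
    ⟨by rw [Measure.restrict_apply_univ]
        exact lt_of_le_of_lt (measure_mono hsub) hfin.lt_top⟩
  have hmeas : (μ.restrict (sphere F k)).map gaussMap = C • μ.restrict (ball 0 0) := by
    refine ext_of_generate_finite (smallBalls F) ?_ isPiSystem_smallBalls ?_ ?_
    · rw [← isTopologicalBasis_smallBalls.borel_eq_generateFrom]
      exact BorelSpace.measurable_eq
    · rintro _ ⟨x, n, rfl⟩
      have hb := measurableSet_ball x n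
      rw [Measure.map_apply measurable_gaussMap hb,
        Measure.restrict_apply (measurable_gaussMap hb), Measure.smul_apply,
        Measure.restrict_apply hb, smul_eq_mul, Set.inter_comm]
      by_cases hx : x ∈ ball 0 0
      · rw [measure_sphere_inter_preimage_ball μ k n hx, Set.inter_eq_left.2]
        exact ball_subset (Nat.cast_nonneg n) hx
      · have hdisj : Disjoint (ball x n) (ball 0 0) := by
          rw [Set.disjoint_left]
          intro f h1 h2
          rw [← ball_eq_of_mem h2, mem_ball_comm] at hx
          exact hx (ball_subset (Nat.cast_nonneg n) (self_mem_ball x 0) h1)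
        rw [hdisj.inter_eq, measure_empty, mul_zero]
        convert measure_empty (μ := μ)
        rw [Set.eq_empty_iff_forall_notMem]
        rintro f ⟨-, hf⟩
        exact Set.disjoint_left.1 hdisj hf (mem_ball_zero.2 (zero_lt_orderTop_gaussMap f))
    · rw [Measure.map_apply measurable_gaussMap .univ, Set.preimage_univ,
        Measure.restrict_apply_univ, Measure.smul_apply, Measure.restrict_apply_univ, smul_eq_mul,
        hC]
  have h2 := congrArg (fun ν => ν B) hmeas
  simp only [Measure.map_apply measurable_gaussMap hB,
    Measure.restrict_apply (measurable_gaussMap hB), Measure.smul_apply,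
    Measure.restrict_apply hB, smul_eq_mul] at h2
  rw [Set.inter_comm, h2, hC]
  ring

end

section

variable {F : Type*} [Field F]

/-! ### Strong law of large numbers for the digit degrees -/

lemma digit_gaussMap (f : LaurentSeries F) (i : ℕ) : digit (gaussMap f) i = digit f (i + 1) := by
  rw [digit, digit, Function.iterate_succ_apply]

lemma digit_iterate (f : LaurentSeries F) (i j : ℕ) :
    digit (gaussMap^[i] f) j = digit f (i + j) := by
  rw [digit, digit, add_comm, Function.iterate_add_apply]

lemma digit_zero_eq_iff {k : ℕ} (hk : 1 ≤ k) (f : LaurentSeries F) :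
    digit f 0 = k ↔ f ∈ sphere F k := by
  rw [digit, Function.iterate_zero, id, sphere, Set.mem_ofPred_eq]
  rcases eq_or_ne f 0 with rfl | hf
  · simp
    omega
  · rw [← HahnSeries.order_eq_orderTop_of_ne_zero hf, WithTop.coe_inj]
    omega

lemma one_lt_card_real (F : Type*) [Field F] [Fintype F] : (1 : ℝ) < Fintype.card F := by
  exact_mod_cast Fintype.one_lt_card

/-- A non-terminating expansion whose digit degrees have the almost sure mean `q / (q - 1)`. -/
def IsTypical [Fintype F] (f : LaurentSeries F) : Prop :=
  NonTerminating f ∧ Tendsto (fun i : ℕ => (digitSum f i : ℝ) / i) atTop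
    (𝓝 (Fintype.card F / (Fintype.card F - 1)))

lemma IsTypical.of_gaussMap [Fintype F] {f : LaurentSeries F} (hf : f ∈ sphere F 0)
    (h : IsTypical (gaussMap f)) : IsTypical f := by
  refine ⟨⟨?_, ?_⟩, ?_⟩
  · rw [show f.orderTop = _ from hf]
    simp
  · rintro (_ | i)
    · exact ne_zero_of_orderTop_eq hf
    · rw [Function.iterate_succ_apply]
      exact h.1.2 i
  · rw [← tendsto_add_atTop_iff_nat 1]
    have h0 : digit f 0 = 0 := by
      rw [digit, Function.iterate_zero, id, order_eq_of_orderTop_eq hf]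
      rfl
    have hs : ∀ i, digitSum f (i + 1) = digitSum (gaussMap f) i := by
      intro i
      simp [digitSum, Finset.sum_range_succ', h0, digit_gaussMap]
    have h2 := h.2.mul (tendsto_natCast_div_add_atTop (1 : ℝ))
    rw [mul_one] at h2
    refine h2.congr' ?_
    filter_upwards [eventually_gt_atTop 0] with i hi
    have hi' : (i : ℝ) ≠ 0 := by positivity
    rw [hs]
    push_cast
    field_simp

variable [MeasurableSpace (LaurentSeries F)]

/-- The restriction of `μ` to the series of negative degree, normalized to a probability
measure. -/
def unitMeasure (μ : Measure (LaurentSeries F)) : Measure (LaurentSeries F) :=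
  (μ (ball 0 0))⁻¹ • μ.restrict (ball 0 0)

lemma unitMeasure_apply (μ : Measure (LaurentSeries F)) {B : Set (LaurentSeries F)} (hB : MeasurableSet B) :
    unitMeasure μ B = (μ (ball 0 0))⁻¹ * μ (B ∩ ball 0 0) := by
  rw [unitMeasure, Measure.smul_apply, Measure.restrict_apply hB, smul_eq_mul]

lemma measure_unitBall_ne_top (μ : Measure (LaurentSeries F)) (hfin : μ (ball 0 (-1)) ≠ ⊤) : μ (ball 0 0) ≠ ⊤ :=
  measure_ne_top_of_subset (ball_subset (by norm_num) (self_mem_ball _ _)) hfin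

lemma measure_unitBall_ne_zero (μ : Measure (LaurentSeries F)) [μ.IsAddHaarMeasure] :
    μ (ball 0 0) ≠ 0 :=
  ((isOpen_ball 0 0).measure_pos μ ⟨0, self_mem_ball 0 0⟩).ne'

lemma isProbabilityMeasure_unitMeasure (μ : Measure (LaurentSeries F))
    [μ.IsAddHaarMeasure] (hfin : μ (ball 0 (-1)) ≠ ⊤) :
    IsProbabilityMeasure (unitMeasure μ) :=
  ⟨by rw [unitMeasure_apply μ .univ, Set.univ_inter, ENNReal.inv_mul_cancel
    (measure_unitBall_ne_zero μ) (measure_unitBall_ne_top μ hfin)]⟩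

variable [BorelSpace (LaurentSeries F)]

lemma measurable_digit_zero : Measurable fun f : LaurentSeries F => digit f 0 := by
  refine measurable_to_countable' fun k => ?_
  have hpos : ∀ k : ℕ, 1 ≤ k →
      MeasurableSet ((fun f : LaurentSeries F => digit f 0) ⁻¹' {k}) := by
    intro k hk
    convert measurableSet_sphere (F := F) k using 1
    ext f
    simp [digit_zero_eq_iff hk]
  rcases Nat.eq_zero_or_pos k with rfl | hk
  · convert (MeasurableSet.iUnion fun j : ℕ => hpos (j + 1) (by omega)).compl using 1
    ext f
    simp only [Set.mem_preimage, Set.mem_singleton_iff, Set.mem_compl_iff, Set.mem_iUnion,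
      not_exists]
    exact ⟨fun h j => by omega, fun h => by
      by_contra h0
      exact h (digit f 0 - 1) (by omega)⟩
  · exact hpos k hk

lemma measurable_digit (i : ℕ) : Measurable fun f : LaurentSeries F => digit f i :=
  measurable_digit_zero.comp (measurable_gaussMap.iterate i)

variable (μ : Measure (LaurentSeries F))

lemma ae_unitMeasure_mem_ball : ∀ᵐ f ∂unitMeasure μ, f ∈ ball 0 0 :=
  Measure.ae_smul_measure (ae_restrict_mem (measurableSet_ball _ _)) _

variable [μ.IsAddHaarMeasure]

variable [Fintype F]

lemma unitMeasure_ball (hfin : μ (ball 0 (-1)) ≠ ⊤) (j : ℕ) :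
    unitMeasure μ (ball 0 j) = (Fintype.card F : ENNReal)⁻¹ ^ j := by
  rw [unitMeasure_apply μ (measurableSet_ball _ _), Set.inter_eq_left.2
    (ball_subset (Nat.cast_nonneg j) (self_mem_ball _ _))]
  have h := measure_ball_add μ 0 j
  rw [zero_add] at h
  rw [h, mul_comm, mul_assoc, ENNReal.mul_inv_cancel (measure_unitBall_ne_zero μ)
    (measure_unitBall_ne_top μ hfin), mul_one]

lemma unitMeasure_singleton_zero (hfin : μ (ball 0 (-1)) ≠ ⊤) : unitMeasure μ {0} = 0 := by
  rw [unitMeasure_apply μ (measurableSet_singleton _), measure_mono_null Set.inter_subset_left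
    (measure_singleton_zero μ (measure_unitBall_ne_top μ hfin)), mul_zero]

lemma ae_unitMeasure_ne_zero (hfin : μ (ball 0 (-1)) ≠ ⊤) : ∀ᵐ f ∂unitMeasure μ, f ≠ 0 := by
  rw [ae_iff]
  simpa using unitMeasure_singleton_zero μ hfin

lemma unitMeasure_digit_inter_preimage (hfin : μ (ball 0 (-1)) ≠ ⊤) (k : ℕ)
    {B : Set (LaurentSeries F)} (hB : MeasurableSet B) :
    unitMeasure μ ({f | digit f 0 = k} ∩ gaussMap ⁻¹' B) =
      unitMeasure μ {f | digit f 0 = k} * unitMeasure μ B := by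
  rcases Nat.eq_zero_or_pos k with rfl | hk
  · -- among the series of negative degree only `0` has vanishing first digit degree
    have h0 : unitMeasure μ {f | digit f 0 = 0} = 0 := by
      have h1 : ∀ᵐ f ∂unitMeasure μ, digit f 0 ≠ 0 := by
        filter_upwards [ae_unitMeasure_ne_zero μ hfin, ae_unitMeasure_mem_ball μ] with f hf hb
        rw [mem_ball_zero, ← HahnSeries.order_eq_orderTop_of_ne_zero hf, WithTop.coe_lt_coe] at hb
        rw [digit, Function.iterate_zero, id]
        omega
      simpa [ae_iff] using h1
    rw [h0, zero_mul]
    exact measure_mono_null Set.inter_subset_left h0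
  · have hs : {f : LaurentSeries F | digit f 0 = k} = sphere F k := by
      ext f
      exact digit_zero_eq_iff hk f
    have hsub : sphere F k ⊆ ball 0 0 := by
      rw [sphere_eq]
      exact Set.sdiff_subset.trans (ball_subset (by omega) (self_mem_ball _ _))
    have hms := measurableSet_sphere (F := F) k
    have h0 := measure_unitBall_ne_zero μ
    have ht := measure_unitBall_ne_top μ hfin
    have key := measure_sphere_inter_preimage μ hfin k hB
    rw [hs, unitMeasure_apply μ (hms.inter (measurable_gaussMap hB)), unitMeasure_apply μ hms,
      unitMeasure_apply μ hB, Set.inter_eq_left.2 (Set.inter_subset_left.trans hsub),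
      Set.inter_eq_left.2 hsub]
    calc _ = (μ (ball 0 0))⁻¹ * (μ (sphere F k ∩ gaussMap ⁻¹' B) * μ (ball 0 0)) *
          (μ (ball 0 0))⁻¹ := by
          rw [mul_assoc, mul_assoc, ENNReal.mul_inv_cancel h0 ht, mul_one]
      _ = _ := by
          rw [key]
          ring

/-- The first digit degree is independent of the image under the Gauss map, and the latter has the
same distribution as the series itself. -/
lemma unitMeasure_preimage_inter_preimage (hfin : μ (ball 0 (-1)) ≠ ⊤) (A : Set ℕ)
    {B : Set (LaurentSeries F)} (hB : MeasurableSet B) :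
    unitMeasure μ ((fun f => digit f 0) ⁻¹' A ∩ gaussMap ⁻¹' B) =
      unitMeasure μ ((fun f => digit f 0) ⁻¹' A) * unitMeasure μ B := by
  have hN := measurable_digit_zero (F := F)
  have h : ((unitMeasure μ).restrict (gaussMap ⁻¹' B)).map (fun f => digit f 0) =
      unitMeasure μ B • (unitMeasure μ).map (fun f => digit f 0) := by
    refine Measure.ext_of_singleton fun k => ?_
    have hk : MeasurableSet ({k} : Set ℕ) := measurableSet_singleton k
    rw [Measure.map_apply hN hk, Measure.restrict_apply (hN hk), Measure.smul_apply,
      Measure.map_apply hN hk, smul_eq_mul, mul_comm]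
    exact unitMeasure_digit_inter_preimage μ hfin k hB
  have h2 := congrArg (fun ν => ν A) h
  simp only [Measure.smul_apply, smul_eq_mul] at h2
  rw [Measure.map_apply hN (Set.to_countable A).measurableSet,
    Measure.map_apply hN (Set.to_countable A).measurableSet,
    Measure.restrict_apply (hN (Set.to_countable A).measurableSet)] at h2
  rw [h2, mul_comm]

lemma measurePreserving_gaussMap (hfin : μ (ball 0 (-1)) ≠ ⊤) :
    MeasurePreserving gaussMap (unitMeasure μ) (unitMeasure μ) := by
  have := isProbabilityMeasure_unitMeasure μ hfin
  refine ⟨measurable_gaussMap, Measure.ext fun B hB => ?_⟩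
  rw [Measure.map_apply measurable_gaussMap hB]
  have h := unitMeasure_preimage_inter_preimage μ hfin Set.univ hB
  rwa [Set.preimage_univ, Set.univ_inter, measure_univ, one_mul] at h

lemma indepFun_digit_of_lt (hfin : μ (ball 0 (-1)) ≠ ⊤) {i j : ℕ} (hij : i < j) :
    ProbabilityTheory.IndepFun (fun f => (digit f i : ℝ)) (fun f => (digit f j : ℝ))
      (unitMeasure μ) := by
  suffices h : ProbabilityTheory.IndepFun (fun f : LaurentSeries F => digit f i)
      (fun f => digit f j) (unitMeasure μ) from
    h.comp (φ := fun n : ℕ => (n : ℝ)) (ψ := fun n : ℕ => (n : ℝ))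
      (measurable_from_top) (measurable_from_top)
  rw [ProbabilityTheory.indepFun_iff_measure_inter_preimage_eq_mul]
  intro s t hs ht
  obtain ⟨d, rfl⟩ : ∃ d, j = i + (d + 1) := ⟨j - i - 1, by omega⟩
  have hmp := measurePreserving_gaussMap μ hfin
  have hB : MeasurableSet ((fun f : LaurentSeries F => digit f d) ⁻¹' t) := measurable_digit d ht
  have e1 : (fun f : LaurentSeries F => digit f i) ⁻¹' s =
      gaussMap^[i] ⁻¹' ((fun f => digit f 0) ⁻¹' s) := by
    ext f
    simp [digit_iterate]
  have e2 : (fun f : LaurentSeries F => digit f (i + (d + 1))) ⁻¹' t =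
      gaussMap^[i] ⁻¹' (gaussMap ⁻¹' ((fun f => digit f d) ⁻¹' t)) := by
    ext f
    simp [digit_gaussMap, digit_iterate]
  have hs' := measurable_digit_zero (F := F) hs
  rw [e1, e2, ← Set.preimage_inter,
    (hmp.iterate i).measure_preimage (hs'.inter (measurable_gaussMap hB)).nullMeasurableSet,
    (hmp.iterate i).measure_preimage hs'.nullMeasurableSet,
    (hmp.iterate i).measure_preimage (measurable_gaussMap hB).nullMeasurableSet,
    hmp.measure_preimage hB.nullMeasurableSet]
  exact unitMeasure_preimage_inter_preimage μ hfin s hB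

/-- The mean of the digit degree, as the sum of its tails `μ(deg > j) = q ^ (-j)`. -/
lemma lintegral_digit_zero (hfin : μ (ball 0 (-1)) ≠ ⊤) :
    ∫⁻ f, (digit f 0 : ENNReal) ∂unitMeasure μ = (1 - (Fintype.card F : ENNReal)⁻¹)⁻¹ := by
  have h1 : ∫⁻ f, (digit f 0 : ENNReal) ∂unitMeasure μ =
      ∫⁻ f, ∑' j : ℕ, (ball (0 : LaurentSeries F) j).indicator 1 f ∂unitMeasure μ := by
    refine lintegral_congr_ae ?_
    filter_upwards [ae_unitMeasure_ne_zero μ hfin] with f hf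
    have hmem : ∀ j : ℕ, f ∈ ball 0 (j : ℤ) ↔ j < digit f 0 := by
      intro j
      rw [mem_ball_zero, ← HahnSeries.order_eq_orderTop_of_ne_zero hf, WithTop.coe_lt_coe, digit,
        Function.iterate_zero, id]
      omega
    rw [tsum_eq_sum (s := Finset.range (digit f 0))]
    · rw [Finset.sum_congr rfl (g := fun _ => (1 : ENNReal))]
      · simp
      · intro j hj
        rw [Set.indicator_of_mem ((hmem j).2 (Finset.mem_range.1 hj))]
        rfl
    · intro j hj
      rw [Set.indicator_of_notMem]
      rwa [hmem, ← Finset.mem_range]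
  rw [h1, lintegral_tsum fun j => (measurable_one.indicator (measurableSet_ball _ _)).aemeasurable,
    ← ENNReal.tsum_geometric]
  refine tsum_congr fun j => ?_
  rw [lintegral_indicator_one (measurableSet_ball _ _), unitMeasure_ball μ hfin]

lemma integrable_digit_zero (hfin : μ (ball 0 (-1)) ≠ ⊤) :
    Integrable (fun f => (digit f 0 : ℝ)) (unitMeasure μ) ∧
      ∫ f, (digit f 0 : ℝ) ∂unitMeasure μ = Fintype.card F / (Fintype.card F - 1) := by
  have hm : Measurable fun f : LaurentSeries F => (digit f 0 : ℝ) :=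
    measurable_from_top.comp measurable_digit_zero
  have hq := one_lt_card_real F
  have hl : ∫⁻ f, ENNReal.ofReal (digit f 0 : ℝ) ∂unitMeasure μ =
      (1 - (Fintype.card F : ENNReal)⁻¹)⁻¹ := by
    simp only [ENNReal.ofReal_natCast]
    exact lintegral_digit_zero μ hfin
  have hinv : (Fintype.card F : ENNReal)⁻¹ < 1 := by
    rw [ENNReal.inv_lt_one]
    exact_mod_cast Fintype.one_lt_card
  constructor
  · refine ⟨hm.aestronglyMeasurable, ?_⟩
    rw [hasFiniteIntegral_iff_ofReal (Eventually.of_forall fun f => Nat.cast_nonneg _), hl]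
    exact ENNReal.inv_lt_top.2 (tsub_pos_of_lt hinv)
  · rw [integral_eq_lintegral_of_nonneg_ae (Eventually.of_forall fun f => Nat.cast_nonneg _)
      hm.aestronglyMeasurable, hl, ENNReal.toReal_inv, ENNReal.toReal_sub_of_le hinv.le (by simp)]
    simp only [ENNReal.toReal_one, ENNReal.toReal_inv, ENNReal.toReal_natCast]
    field_simp

lemma ae_tendsto_digitSum (hfin : μ (ball 0 (-1)) ≠ ⊤) :
    ∀ᵐ f ∂unitMeasure μ, Tendsto (fun i : ℕ => (digitSum f i : ℝ) / i) atTop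
      (𝓝 (Fintype.card F / (Fintype.card F - 1))) := by
  obtain ⟨hint, hval⟩ := integrable_digit_zero μ hfin
  have hm : ∀ i, Measurable fun f : LaurentSeries F => (digit f i : ℝ) := fun i =>
    measurable_from_top.comp (measurable_digit i)
  have h := ProbabilityTheory.strong_law_ae_real (fun i f => (digit f i : ℝ)) hint
    (fun i j hij => by
      rcases lt_or_gt_of_ne hij with hlt | hlt
      · exact indepFun_digit_of_lt μ hfin hlt
      · exact (indepFun_digit_of_lt μ hfin hlt).symm)
    (fun i => by
      refine ⟨(hm i).aemeasurable, (hm 0).aemeasurable, ?_⟩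
      have hmp := (measurePreserving_gaussMap μ hfin).iterate i
      have e : (fun f : LaurentSeries F => (digit f i : ℝ)) =
          (fun f => (digit f 0 : ℝ)) ∘ gaussMap^[i] := by
        ext f
        simp [digit_iterate]
      rw [e, ← Measure.map_map (hm 0) hmp.measurable, hmp.map_eq])
  rw [hval] at h
  filter_upwards [h] with f hf
  simpa [digitSum] using hf

lemma ae_isTypical_of_mem_ball (hfin : μ (ball 0 (-1)) ≠ ⊤) :
    ∀ᵐ f ∂μ, f ∈ ball 0 0 → IsTypical f := by
  rw [← ae_restrict_iff' (measurableSet_ball _ _)]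
  have h : ∀ᵐ f ∂unitMeasure μ, IsTypical f := by
    have h0 : ∀ᵐ f ∂unitMeasure μ, ∀ i, gaussMap^[i] f ≠ 0 := by
      rw [ae_all_iff]
      intro i
      exact ((measurePreserving_gaussMap μ hfin).iterate i).quasiMeasurePreserving.ae
        (ae_unitMeasure_ne_zero μ hfin)
    filter_upwards [h0, ae_unitMeasure_mem_ball μ, ae_tendsto_digitSum μ hfin] with f h1 h2 h3
    exact ⟨⟨(mem_ball_zero.1 h2).le, h1⟩, h3⟩
  rwa [unitMeasure, Measure.ae_ennreal_smul_measure_iff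
    (ENNReal.inv_ne_zero.2 (measure_unitBall_ne_top μ hfin))] at h

/-- A series of degree `0` is sent into the series of negative degree by the Gauss map, which pulls
null sets back to null sets there as well. -/
lemma ae_isTypical (hfin : μ (ball 0 (-1)) ≠ ⊤) :
    ∀ᵐ f ∂μ, f ∈ ball 0 (-1) → IsTypical f := by
  have h := ae_isTypical_of_mem_ball μ hfin
  set B := toMeasurable μ {f | ¬ (f ∈ ball 0 0 → IsTypical f)}
  have hB0 : μ B = 0 := by rw [measure_toMeasurable]; exact h
  have h1 := measure_sphere_inter_preimage μ hfin 0
    (measurableSet_toMeasurable μ _ : MeasurableSet B)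
  rw [measure_mono_null Set.inter_subset_left hB0, mul_zero, mul_eq_zero,
    or_iff_left (measure_unitBall_ne_zero μ)] at h1
  filter_upwards [h, measure_eq_zero_iff_ae_notMem.1 h1] with f hf hf1 hO
  by_cases hm : f ∈ ball 0 0
  · exact hf hm
  · have hs : f ∈ sphere F 0 := by
      rw [sphere_eq]
      exact ⟨by simpa using hO, hm⟩
    refine IsTypical.of_gaussMap hs ?_
    by_contra hT
    refine hf1 ⟨hs, subset_toMeasurable μ _ ?_⟩
    exact fun h => hT (h (mem_ball_zero.2 (zero_lt_orderTop_gaussMap f)))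

end

section

/-! ### From digits to Farey steps -/

/-- If the partial sums `s` of a sequence of natural numbers `n` satisfy `s i / i → m`, and a
sequence `e` satisfies `e ≈ 2 (s i + k)` at the index `s i + i + k`, for `k ≤ n i`, with an error of
the size of the neighbouring terms, then `e ℓ / ℓ → 2 m / (m + 1)`. -/
lemma tendsto_div_of_block_bound {n s : ℕ → ℕ} (hs0 : s 0 = 0) (hs : ∀ i, s (i + 1) = s i + n i)
    {m : ℝ} (hm : 0 ≤ m) (hlim : Tendsto (fun i : ℕ => (s i : ℝ) / i) atTop (𝓝 m)) {e : ℕ → ℝ}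
    (he : ∀ i k, 1 ≤ i → k ≤ n i →
      |e (s i + i + k) - 2 * (s i + k : ℝ)| ≤ n i + n (i - 1)) :
    Tendsto (fun ℓ : ℕ => e ℓ / ℓ) atTop (𝓝 (2 * m / (m + 1))) := by
  have hcast : ∀ i, (s (i + 1) : ℝ) = s i + n i := fun i => by rw [hs]; push_cast; ring
  -- `n i / i → 0`, and likewise for the shifted sequence
  have hn1 : Tendsto (fun i : ℕ => (n i : ℝ) / (i + 1 : ℕ)) atTop (𝓝 0) := by
    have h1 := (hlim.comp (tendsto_add_atTop_nat 1)).sub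
      (hlim.mul (tendsto_natCast_div_add_atTop (1 : ℝ)))
    rw [mul_one, sub_self] at h1
    refine h1.congr' ?_
    filter_upwards [eventually_gt_atTop 0] with i hi
    have hi' : (i : ℝ) ≠ 0 := by positivity
    have hi2 : (i : ℝ) + 1 ≠ 0 := by positivity
    simp only [Function.comp_apply, hcast]
    push_cast
    field_simp
    ring
  have hn : Tendsto (fun i : ℕ => (n i : ℝ) / i) atTop (𝓝 0) := by
    have h1 := hn1.mul (tendsto_const_nhds.add tendsto_one_div_atTop_nhds_zero_nat :
      Tendsto (fun i : ℕ => (1 : ℝ) + 1 / (i : ℝ)) atTop (𝓝 (1 + 0)))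
    rw [zero_mul] at h1
    refine h1.congr' ?_
    filter_upwards [eventually_gt_atTop 0] with i hi
    have hi' : (i : ℝ) ≠ 0 := by positivity
    have hi2 : (i : ℝ) + 1 ≠ 0 := by positivity
    push_cast
    field_simp
  have hnp : Tendsto (fun i : ℕ => (n (i - 1) : ℝ) / i) atTop (𝓝 0) := by
    rw [← tendsto_add_atTop_iff_nat 1]
    simpa using hn1
  -- every index lies in exactly one block
  have hblock : ∀ ℓ : ℕ, ∃ i k, k ≤ n i ∧ s i + i + k = ℓ := by
    intro ℓ
    induction ℓ with
    | zero => exact ⟨0, 0, Nat.zero_le _, by simp [hs0]⟩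
    | succ ℓ ih =>
      obtain ⟨i, k, hk, rfl⟩ := ih
      rcases Nat.lt_or_ge k (n i) with h | h
      · exact ⟨i, k + 1, h, by omega⟩
      · exact ⟨i + 1, 0, Nat.zero_le _, by rw [hs]; omega⟩
  choose I K hK hIK using hblock
  have hmono : Monotone s := monotone_nat_of_le_succ fun i => by rw [hs]; omega
  have hI : Tendsto I atTop atTop := by
    rw [tendsto_atTop]
    intro M
    filter_upwards [eventually_ge_atTop (s M + M)] with ℓ hℓ
    by_contra hlt
    have h1 := hmono (show I ℓ + 1 ≤ M by omega)
    have h2 := hK ℓ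
    have h3 := hIK ℓ
    rw [hs] at h1
    omega
  have hKI : Tendsto (fun ℓ => (K ℓ : ℝ) / I ℓ) atTop (𝓝 0) := by
    refine squeeze_zero (fun ℓ => by positivity) (fun ℓ => ?_) (hn.comp hI)
    exact div_le_div_of_nonneg_right (by exact_mod_cast hK ℓ) (Nat.cast_nonneg _)
  have hnum : Tendsto (fun ℓ => e ℓ / I ℓ) atTop (𝓝 (2 * m)) := by
    have h1 := (((hlim.comp hI).add hKI).const_mul 2)
    rw [add_zero] at h1
    have h2 : Tendsto (fun ℓ => e ℓ / I ℓ - 2 * ((s (I ℓ) : ℝ) / I ℓ + (K ℓ : ℝ) / I ℓ)) atTop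
        (𝓝 0) := by
      have h3 := (hn.comp hI).add (hnp.comp hI)
      rw [add_zero] at h3
      refine squeeze_zero_norm' ?_ h3
      filter_upwards [hI.eventually_ge_atTop 1] with ℓ hℓ
      have h4 := he (I ℓ) (K ℓ) hℓ (hK ℓ)
      rw [hIK] at h4
      have hpos : (0 : ℝ) < I ℓ := by exact_mod_cast hℓ
      have h5 : e ℓ / I ℓ - 2 * ((s (I ℓ) : ℝ) / I ℓ + (K ℓ : ℝ) / I ℓ) =
          (e ℓ - 2 * (s (I ℓ) + K ℓ : ℝ)) / I ℓ := by ring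
      rw [h5, Real.norm_eq_abs, abs_div, abs_of_pos hpos]
      simp only [Function.comp_apply]
      rw [← add_div]
      exact div_le_div_of_nonneg_right h4 hpos.le
    simpa using h2.add h1
  have hden : Tendsto (fun ℓ : ℕ => (ℓ : ℝ) / I ℓ) atTop (𝓝 (m + 1)) := by
    have h1 := ((hlim.comp hI).add hKI).add (tendsto_const_nhds (x := (1 : ℝ)))
    rw [add_zero] at h1
    refine h1.congr' ?_
    filter_upwards [hI.eventually_ge_atTop 1] with ℓ hℓ
    have hpos : (I ℓ : ℝ) ≠ 0 := by
      have : (0 : ℝ) < I ℓ := by exact_mod_cast hℓ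
      exact this.ne'
    have h2 : (ℓ : ℝ) = s (I ℓ) + I ℓ + K ℓ := by exact_mod_cast (hIK ℓ).symm
    rw [h2, Function.comp_apply]
    field_simp
    ring
  refine (hnum.div hden (by positivity)).congr' ?_
  filter_upwards [hI.eventually_ge_atTop 1] with ℓ hℓ
  have hpos : (I ℓ : ℝ) ≠ 0 := by
    have : (0 : ℝ) < I ℓ := by exact_mod_cast hℓ
    exact this.ne'
  exact div_div_div_cancel_right₀ hpos _ _

end

section

variable {F : Type*} [Field F] [Fintype F]

/-! ### The error exponent of the Farey convergents -/

lemma absVal_le_one_iff (f : LaurentSeries F) : absVal f ≤ 1 ↔ f ∈ ball 0 (-1) := by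
  have hq := one_lt_card_real F
  rw [mem_ball_zero, absVal]
  split_ifs with hf
  · simp only [hf, HahnSeries.orderTop_zero, zero_le_one, WithTop.coe_lt_top]
  · rw [← HahnSeries.order_eq_orderTop_of_ne_zero hf, WithTop.coe_lt_coe,
      zpow_le_one_iff_right₀ hq]
    omega

lemma logb_absVal {f : LaurentSeries F} (hf : f ≠ 0) :
    Real.logb (Fintype.card F : ℝ) (absVal f) = -f.order := by
  have hq := one_lt_card_real F
  rw [absVal, if_neg hf, ← Real.rpow_intCast, Real.logb_rpow (by linarith) hq.ne']
  push_cast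
  rfl

lemma IsTypical.tendsto_logb_error {f h : LaurentSeries F} (hf : IsTypical f)
    (hh : deg h = ((-1 : ℤ) : WithBot ℤ)) :
    Tendsto (fun ℓ : ℕ => (1 / (ℓ : ℝ)) * Real.logb (Fintype.card F : ℝ)
        (absVal (f - convNum h f ℓ / convDen h f ℓ))) atTop
      (𝓝 (-(2 * (Fintype.card F : ℝ) / (2 * (Fintype.card F : ℝ) - 1)))) := by
  have hq := one_lt_card_real F
  have hm : (0 : ℝ) ≤ Fintype.card F / (Fintype.card F - 1) :=
    div_nonneg (by linarith) (by linarith)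
  have key := tendsto_div_of_block_bound (n := digit f) (s := digitSum f) rfl (digitSum_succ f) hm
    hf.2 (e := fun ℓ => -Real.logb (Fintype.card F : ℝ)
      (absVal (f - convNum h f ℓ / convDen h f ℓ))) (by
      intro i k hi hk
      obtain ⟨h0, hb⟩ := hf.1.abs_order_error_sub_le (orderTop_eq_one_of_deg hh) hi hk
      rw [logb_absVal h0, neg_neg]
      exact_mod_cast hb)
  have hval : 2 * ((Fintype.card F : ℝ) / (Fintype.card F - 1)) /
      ((Fintype.card F : ℝ) / (Fintype.card F - 1) + 1) =
      2 * (Fintype.card F : ℝ) / (2 * (Fintype.card F : ℝ) - 1) := by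
    have h1 : (Fintype.card F : ℝ) - 1 ≠ 0 := by linarith
    have h2 : 2 * (Fintype.card F : ℝ) - 1 ≠ 0 := by linarith
    have h3 : (Fintype.card F : ℝ) / (Fintype.card F - 1) + 1 =
        (2 * (Fintype.card F : ℝ) - 1) / (Fintype.card F - 1) := by
      field_simp
      ring
    rw [h3]
    field_simp
  rw [hval] at key
  refine key.neg.congr fun ℓ => ?_
  ring

end

end FareyMap

end

theorem theorem3 {F : Type*} [Field F] [Fintype F]
    [MeasurableSpace (LaurentSeries F)] [BorelSpace (LaurentSeries F)]
    (μ : Measure (LaurentSeries F)) [μ.IsAddHaarMeasure]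
    (hμ : μ {f : LaurentSeries F | FareyMap.absVal f ≤ 1} = 1)
    (h : LaurentSeries F) (hh : FareyMap.deg h = ((-1 : ℤ) : WithBot ℤ)) :
    ∀ᵐ f ∂μ, FareyMap.absVal f ≤ 1 →
      Tendsto
        (fun ℓ : ℕ => (1 / (ℓ : ℝ)) * Real.logb (Fintype.card F : ℝ)
          (FareyMap.absVal (f - FareyMap.convNum h f ℓ / FareyMap.convDen h f ℓ)))
        atTop
        (𝓝 (-(2 * (Fintype.card F : ℝ) / (2 * (Fintype.card F : ℝ) - 1)))) := by
  have hO : {f : LaurentSeries F | FareyMap.absVal f ≤ 1} = FareyMap.ball 0 (-1) :=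
    Set.ext FareyMap.absVal_le_one_iff
  have hfin : μ (FareyMap.ball 0 (-1)) ≠ ⊤ := by
    rw [← hO, hμ]
    exact ENNReal.one_ne_top
  filter_upwards [FareyMap.ae_isTypical μ hfin] with f hf hle
  exact (hf ((FareyMap.absVal_le_one_iff f).1 hle)).tendsto_logb_error hh
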